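/- Let $p$ be any prime, and let $G=Q_{4p^2}=\langle a,b : a^{2p^2}=1,\ b^2=a^{p^2},\ bab^{-1}=a^{-1}\rangle$ be the dicyclic group of order $4p^2$. Let $\mathcal{B}(G)$ be the subgroup generating bipartite graph of $G$: its vertex set is the disjoint union of $G\times G$ and the set $L(G)$ of all subgroups of $G$, and its edges join each $(x,y)\in G\times G$ to the subgroup $\langle x,y\rangle\in L(G)$ (and there are no other edges). For a finite simple graph $\mathcal{G}$ with $n$ vertices $v_1,\dots,v_n$ and $m$ edges, let $A$ be its adjacency matrix, $D$ its diagonal degree matrix, and $CN$ its common neighborhood matrix, i.e. the $n\times n$ matrix whose $(i,j)$ entry is the number of common neighbors of $v_i$ and $v_j$ if $i\ne j$, and $0$ if $i=j$. With all eigenvalues counted with multiplicity, put $$E(\mathcal{G})=\sum_{\alpha\in\operatorname{Spec}(A)}|\alpha|,\qquad E_{CN}(\mathcal{G})=\sum_{\beta\in\operatorname{Spec}(CN)}|\beta|,$$ $$LE(\mathcal{G})=\sum_{\lambda\in\operatorname{Spec}(D-A)}\left|\lambda-\tfrac{2m}{n}\right|,\qquad LE^+(\mathcal{G})=\sum_{\mu\in\operatorname{Spec}(D+A)}\left|\mu-\tfrac{2m}{n}\right|.$$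 The graph $\mathcal{G}$ is called hypoenergetic if $E(\mathcal{G})<n$, hyperenergetic if $E(\mathcal{G})>E(K_n)$, L-hyperenergetic if $LE(\mathcal{G})>LE(K_n)$, Q-hyperenergetic if $LE^+(\mathcal{G})>LE^+(K_n)$, and CN-hyperenergetic if $E_{CN}(\mathcal{G})>E_{CN}(K_n)$, where $K_n$ is the complete graph on $n$ vertices. **Theorem.** The graph $\mathcal{B}(Q_{4p^2})$ is hypoenergetic, and it is not hyperenergetic, not L-hyperenergetic, not Q-hyperenergetic and not CN-hyperenergetic. -/

import Mathlib

open scoped Classical in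
/-- The spectrum of a real symmetric matrix: the multiset of its eigenvalues, each repeated
according to its multiplicity. -/
noncomputable def matrixSpec {V : Type*} [Fintype V] (M : Matrix V V ℝ) : Multiset ℝ :=
  M.charpoly.roots

open scoped Classical in
/-- For a symmetric matrix all `n` eigenvalues are real, and `matrixSpec` lists all of them. -/
theorem matrixSpec_eq_eigenvalues {V : Type*} [Fintype V] (M : Matrix V V ℝ)
    (hM : M.IsHermitian) : matrixSpec M = Finset.univ.val.map hM.eigenvalues :=
  hM.roots_charpoly_eq_eigenvalues

namespace SimpleGraph

variable {V : Type*} [Fintype V]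

open scoped Classical in
/-- The adjacency matrix `A`. -/
noncomputable def adjacencyMatrix (Γ : SimpleGraph V) : Matrix V V ℝ := Γ.adjMatrix ℝ

open scoped Classical in
/-- The Laplacian matrix `L = D - A`. -/
noncomputable def laplacianMatrix (Γ : SimpleGraph V) : Matrix V V ℝ :=
  Γ.degMatrix ℝ - Γ.adjMatrix ℝ

open scoped Classical in
/-- The signless Laplacian matrix `Q = D + A`. -/
noncomputable def signlessLaplacianMatrix (Γ : SimpleGraph V) : Matrix V V ℝ :=
  Γ.degMatrix ℝ + Γ.adjMatrix ℝ

open scoped Classical in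
/-- The common neighborhood matrix: the number of common neighbors of `v` and `w` off the
diagonal, and `0` on the diagonal. -/
noncomputable def cnMatrix (Γ : SimpleGraph V) : Matrix V V ℝ :=
  Matrix.of fun v w => if v = w then 0 else ((Γ.commonNeighbors v w).ncard : ℝ)

/-- The average degree `2m / n`, with `m` the number of edges and `n` the number of vertices. -/
noncomputable def averageDegree (Γ : SimpleGraph V) : ℝ :=
  2 * (Γ.edgeSet.ncard : ℝ) / (Fintype.card V : ℝ)

/-- The energy `E`. -/
noncomputable def energy (Γ : SimpleGraph V) : ℝ :=
  ((matrixSpec Γ.adjacencyMatrix).map fun α => |α|).sum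

/-- The Laplacian energy `LE`. -/
noncomputable def laplacianEnergy (Γ : SimpleGraph V) : ℝ :=
  ((matrixSpec Γ.laplacianMatrix).map fun μ => |μ - Γ.averageDegree|).sum

/-- The signless Laplacian energy `LE⁺`. -/
noncomputable def signlessLaplacianEnergy (Γ : SimpleGraph V) : ℝ :=
  ((matrixSpec Γ.signlessLaplacianMatrix).map fun μ => |μ - Γ.averageDegree|).sum

/-- The common neighborhood energy `E_CN`. -/
noncomputable def cnEnergy (Γ : SimpleGraph V) : ℝ :=
  ((matrixSpec Γ.cnMatrix).map fun β => |β|).sum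

/-- `E(Γ) < n`. -/
def IsHypoenergetic (Γ : SimpleGraph V) : Prop :=
  Γ.energy < (Fintype.card V : ℝ)

/-- `E(Γ) > E(K_n)`. -/
def IsHyperenergetic (Γ : SimpleGraph V) : Prop :=
  Γ.energy > (completeGraph (Fin (Fintype.card V))).energy

/-- `LE(Γ) > LE(K_n)`. -/
def IsLHyperenergetic (Γ : SimpleGraph V) : Prop :=
  Γ.laplacianEnergy > (completeGraph (Fin (Fintype.card V))).laplacianEnergy

/-- `LE⁺(Γ) > LE⁺(K_n)`. -/
def IsQHyperenergetic (Γ : SimpleGraph V) : Prop :=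
  Γ.signlessLaplacianEnergy >
    (completeGraph (Fin (Fintype.card V))).signlessLaplacianEnergy

/-- `E_CN(Γ) > E_CN(K_n)`. -/
def IsCNHyperenergetic (Γ : SimpleGraph V) : Prop :=
  Γ.cnEnergy > (completeGraph (Fin (Fintype.card V))).cnEnergy

end SimpleGraph

/-- The subgroup generating bipartite graph of a group `G`: its vertex set is the disjoint union
of `G × G` and the set of all subgroups of `G`, and its edges join each pair `(a, b)` to the
subgroup generated by `a` and `b`. -/
def sgbGraph (G : Type*) [Group G] : SimpleGraph ((G × G) ⊕ Subgroup G) where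
  Adj
    | Sum.inl x, Sum.inr H => Subgroup.closure {x.1, x.2} = H
    | Sum.inr H, Sum.inl x => Subgroup.closure {x.1, x.2} = H
    | _, _ => False
  symm := ⟨by rintro (x | H) (y | K) h <;> exact h⟩
  loopless := ⟨by rintro (x | H) h <;> exact h⟩

/-! Every pair is adjacent to exactly one subgroup, so the graph is a disjoint union of stars
centred at the subgroups, with `d y` leaves at `y`. The argument works for every nontrivial finite
group. Put N = |G × G|, S = |L(G)|, n = N + S.

Upper bounds: writing M - c = P - Q + r with P, Q positive semidefinite bounds the energy by tr P +
tr Q + |r| n. Here P and Q are built from rank one blocks, one per star, so only traces are needed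
and no spectrum is computed. This gives ∑ 2√d for E, n + |S - N| ≤ 2(n - 1) for LE and LE⁺, and 2N
for CN. Since 2√d ≤ d + 1 and ∑ (d + 1) = n, E is at most n, and strictly less because some star has
two leaves.

Lower bounds for `K_n`: deviations from the mean eigenvalue sum to zero, so the eigenvalue of the
all-ones vector alone forces twice its deviation. -/

open scoped Matrix

/-! ### Trace and eigenvector bounds for spectral deviations -/

namespace Matrix

variable {V : Type*} [Fintype V]

open scoped Classical in
/-- If `M - c = P - Q + r` with `P` and `Q` positive semidefinite, then the traces of `P` and `Q`
bound the absolute deviation of the spectrum of `M` from `c`. -/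
theorem sum_abs_matrixSpec_sub_le {M P Q : Matrix V V ℝ} (hM : M.IsHermitian)
    (hP : P.PosSemidef) (hQ : Q.PosSemidef) {c r : ℝ}
    (h : M - c • (1 : Matrix V V ℝ) = P - Q + r • (1 : Matrix V V ℝ)) :
    ((matrixSpec M).map fun μ => |μ - c|).sum ≤ P.trace + Q.trace + |r| * Fintype.card V := by
  rw [matrixSpec_eq_eigenvalues M hM, Multiset.map_map]
  set U : Matrix V V ℝ := ↑hM.eigenvectorUnitary with hU
  have hUU : Uᴴ * U = 1 := Unitary.coe_star_mul_self hM.eigenvectorUnitary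
  have hUU' : U * Uᴴ = 1 := Unitary.coe_mul_star_self hM.eigenvectorUnitary
  have hdiag : Uᴴ * M * U = diagonal hM.eigenvalues := by
    have := hM.conjStarAlgAut_star_eigenvectorUnitary
    rw [Unitary.conjStarAlgAut_star_apply] at this
    simpa [hU, star_eq_conjTranspose, Function.comp_def] using this
  have htr : ∀ N : Matrix V V ℝ, (Uᴴ * N * U).trace = N.trace := fun N => by
    rw [trace_mul_comm, ← Matrix.mul_assoc, hUU', Matrix.one_mul]
  have key : ∀ i, hM.eigenvalues i - c = (Uᴴ * P * U) i i - (Uᴴ * Q * U) i i + r := fun i => by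
    have h1 := congrArg (fun N : Matrix V V ℝ => (Uᴴ * N * U) i i) h
    simpa only [Matrix.mul_sub, Matrix.sub_mul, Matrix.mul_add, Matrix.add_mul, hdiag, hUU,
      Matrix.mul_smul, Matrix.smul_mul, Matrix.mul_one, sub_apply, add_apply, smul_apply,
      diagonal_apply_eq, one_apply_eq, smul_eq_mul, mul_one] using h1
  -- In an eigenbasis of `M` the conjugates of `P` and `Q` keep nonnegative diagonals, whatever
  -- their off-diagonal entries.
  have hb : ∀ i, |hM.eigenvalues i - c| ≤ (Uᴴ * P * U) i i + (Uᴴ * Q * U) i i + |r| := fun i => by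
    have hp : 0 ≤ (Uᴴ * P * U) i i := (hP.conjTranspose_mul_mul_same U).diag_nonneg
    have hq : 0 ≤ (Uᴴ * Q * U) i i := (hQ.conjTranspose_mul_mul_same U).diag_nonneg
    rw [key i, abs_le]
    constructor <;> linarith [neg_abs_le r, le_abs_self r]
  calc ∑ i, |hM.eigenvalues i - c|
      ≤ ∑ i, ((Uᴴ * P * U) i i + (Uᴴ * Q * U) i i + |r|) := Finset.sum_le_sum fun i _ => hb i
    _ = (Uᴴ * P * U).trace + (Uᴴ * Q * U).trace + |r| * Fintype.card V := by
        simp [Finset.sum_add_distrib, trace, mul_comm]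
    _ = _ := by rw [htr, htr]

open scoped Classical in
/-- If `c` is the mean of the eigenvalues of `M`, then any eigenvalue contributes at least twice
its deviation from `c` to the absolute deviation of the spectrum. -/
theorem two_mul_abs_sub_le_sum_abs_matrixSpec_sub {M : Matrix V V ℝ} (hM : M.IsHermitian)
    {c μ : ℝ} {v : V → ℝ} (hv : v ≠ 0) (hμ : M *ᵥ v = μ • v)
    (hc : M.trace = c * Fintype.card V) :
    2 * |μ - c| ≤ ((matrixSpec M).map fun μ => |μ - c|).sum := by
  rw [matrixSpec_eq_eigenvalues M hM, Multiset.map_map]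
  have hmem : μ ∈ Set.range hM.eigenvalues := by
    rw [← hM.spectrum_real_eq_range_eigenvalues, ← spectrum_toLin']
    exact Module.End.HasEigenvalue.mem_spectrum
      (Module.End.hasEigenvalue_of_hasEigenvector (x := v)
        ⟨Module.End.mem_eigenspace_iff.2 (by simpa using hμ), hv⟩)
  obtain ⟨i, hi⟩ := hmem
  have hsum : ∑ j, (hM.eigenvalues j - c) = 0 := by
    have := hM.trace_eq_sum_eigenvalues
    simp only [RCLike.ofReal_real_eq_id, id] at this
    rw [Finset.sum_sub_distrib, ← this, hc]
    simp [mul_comm]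
  change _ ≤ ∑ j, |hM.eigenvalues j - c|
  -- The other deviations add up to minus the `i`-th one, so their absolute values contribute at
  -- least as much again.
  rw [← Finset.add_sum_erase _ _ (Finset.mem_univ i)] at hsum ⊢
  have := Finset.abs_sum_le_sum_abs (fun j => hM.eigenvalues j - c) (Finset.univ.erase i)
  rw [show ∑ j ∈ Finset.univ.erase i, (hM.eigenvalues j - c) = -(hM.eigenvalues i - c) by linarith,
    abs_neg] at this
  rw [← hi]
  linarith

end Matrix

namespace SimpleGraph

variable {V : Type*} (Γ : SimpleGraph V)

theorem adjacencyMatrix_isHermitian : Γ.adjacencyMatrix.IsHermitian := by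
  classical exact Γ.isHermitian_adjMatrix ℝ

theorem cnMatrix_isHermitian : Γ.cnMatrix.IsHermitian := by
  ext v w
  by_cases h : v = w
  · simp [cnMatrix, h]
  · simp [cnMatrix, h, Ne.symm h, commonNeighbors_symm]

variable [Fintype V]

theorem laplacianMatrix_isHermitian : Γ.laplacianMatrix.IsHermitian := by
  classical exact (Γ.isHermitian_degMatrix ℝ).sub (Γ.isHermitian_adjMatrix ℝ)

theorem signlessLaplacianMatrix_isHermitian : Γ.signlessLaplacianMatrix.IsHermitian := by
  classical exact (Γ.isHermitian_degMatrix ℝ).add (Γ.isHermitian_adjMatrix ℝ)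

theorem laplacianMatrix_eq [DecidableEq V] [DecidableRel Γ.Adj] :
    Γ.laplacianMatrix = Γ.degMatrix ℝ - Γ.adjacencyMatrix := by
  unfold laplacianMatrix adjacencyMatrix
  congr!

theorem signlessLaplacianMatrix_eq [DecidableEq V] [DecidableRel Γ.Adj] :
    Γ.signlessLaplacianMatrix = Γ.degMatrix ℝ + Γ.adjacencyMatrix := by
  unfold signlessLaplacianMatrix adjacencyMatrix
  congr!

theorem averageDegree_mul_card [Nonempty V] [DecidableRel Γ.Adj] :
    Γ.averageDegree * Fintype.card V = ∑ v, (Γ.degree v : ℝ) := by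
  have hn : (Fintype.card V : ℝ) ≠ 0 := by exact_mod_cast Fintype.card_ne_zero
  have h : ∑ v, (Γ.degree v : ℝ) = 2 * (Γ.edgeFinset.card : ℝ) := by
    exact_mod_cast Γ.sum_degrees_eq_twice_card_edges
  rw [averageDegree, div_mul_cancel₀ _ hn, h, ← Set.ncard_coe_finset, coe_edgeFinset]

theorem energy_eq : Γ.energy = ((matrixSpec Γ.adjacencyMatrix).map fun α => |α - 0|).sum := by
  simp [energy]

theorem cnEnergy_eq : Γ.cnEnergy = ((matrixSpec Γ.cnMatrix).map fun α => |α - 0|).sum := by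
  simp [cnEnergy]

theorem adjacencyMatrix_trace : Γ.adjacencyMatrix.trace = 0 := by
  classical exact Γ.trace_adjMatrix ℝ

/-! ### Lower bounds for the energies of the complete graph -/

section Complete

variable (n : ℕ)

theorem cnMatrix_completeGraph :
    (completeGraph (Fin n)).cnMatrix = ((n : ℝ) - 2) • (completeGraph (Fin n)).adjacencyMatrix := by
  classical
  ext v w
  by_cases h : v = w
  · simp [cnMatrix, adjacencyMatrix, h]
  · have hc : ((completeGraph (Fin n)).commonNeighbors v w).ncard = n - 2 := by
      have := card_commonNeighbors_top h
      rw [Fintype.card_fin] at this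
      rw [← this, Set.ncard_eq_toFinset_card', Set.toFinset_card]
    -- Two distinct vertices exist, so the natural subtraction `n - 2` is not truncated.
    have h2 : 2 ≤ n := by
      have := Fintype.one_lt_card_iff.2 ⟨v, w, h⟩
      rwa [Fintype.card_fin] at this
    simp [cnMatrix, adjacencyMatrix, h, hc, Nat.cast_sub h2]

variable [NeZero n]

theorem degree_completeGraph_fin [DecidableRel (completeGraph (Fin n)).Adj] (v : Fin n) :
    ((completeGraph (Fin n)).degree v : ℝ) = n - 1 := by
  have h := complete_graph_degree v
  rw [Fintype.card_fin] at h
  rw [← Nat.cast_pred (Nat.pos_of_neZero n), ← h]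
  congr!

theorem averageDegree_completeGraph : (completeGraph (Fin n)).averageDegree = n - 1 := by
  classical
  have hn : (n : ℝ) ≠ 0 := NeZero.ne _
  have h := averageDegree_mul_card (completeGraph (Fin n))
  simp only [degree_completeGraph_fin n, Fintype.card_fin, Finset.sum_const, Finset.card_univ,
    nsmul_eq_mul] at h
  rw [mul_comm] at h
  exact mul_left_cancel₀ hn h

theorem adjacencyMatrix_completeGraph_mulVec_one :
    (completeGraph (Fin n)).adjacencyMatrix *ᵥ 1 = ((n : ℝ) - 1) • (1 : Fin n → ℝ) := by
  classical
  ext v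
  simp only [adjacencyMatrix, adjMatrix_mulVec_apply, Pi.one_apply, Finset.sum_const, nsmul_eq_mul,
    mul_one, Pi.smul_apply, smul_eq_mul, card_neighborFinset_eq_degree]
  rw [degree_completeGraph_fin]

theorem degMatrix_completeGraph [DecidableRel (completeGraph (Fin n)).Adj] :
    (completeGraph (Fin n)).degMatrix ℝ = ((n : ℝ) - 1) • (1 : Matrix (Fin n) (Fin n) ℝ) := by
  rw [degMatrix, ← Matrix.diagonal_one, ← Matrix.diagonal_smul]
  congr 1
  ext v
  simpa using degree_completeGraph_fin n v

theorem le_energy_completeGraph : 2 * ((n : ℝ) - 1) ≤ (completeGraph (Fin n)).energy := by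
  rw [energy_eq]
  refine le_trans ?_ (Matrix.two_mul_abs_sub_le_sum_abs_matrixSpec_sub
    (adjacencyMatrix_isHermitian _) one_ne_zero (adjacencyMatrix_completeGraph_mulVec_one n)
    (by simp [adjacencyMatrix_trace]))
  rw [sub_zero]
  linarith [le_abs_self ((n : ℝ) - 1)]

theorem le_laplacianEnergy_completeGraph :
    2 * ((n : ℝ) - 1) ≤ (completeGraph (Fin n)).laplacianEnergy := by
  classical
  have hL : (completeGraph (Fin n)).laplacianMatrix =
      ((n : ℝ) - 1) • 1 - (completeGraph (Fin n)).adjacencyMatrix := by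
    rw [← degMatrix_completeGraph, laplacianMatrix_eq]
  refine le_trans ?_ (Matrix.two_mul_abs_sub_le_sum_abs_matrixSpec_sub (μ := 0) (v := 1)
    (laplacianMatrix_isHermitian _) one_ne_zero ?_ ?_)
  · rw [averageDegree_completeGraph, zero_sub, abs_neg]
    linarith [le_abs_self ((n : ℝ) - 1)]
  · rw [hL, Matrix.sub_mulVec, adjacencyMatrix_completeGraph_mulVec_one, Matrix.smul_mulVec,
      Matrix.one_mulVec, sub_self, zero_smul]
  · rw [hL, averageDegree_completeGraph]
    simp [adjacencyMatrix_trace]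

theorem le_signlessLaplacianEnergy_completeGraph :
    2 * ((n : ℝ) - 1) ≤ (completeGraph (Fin n)).signlessLaplacianEnergy := by
  classical
  have hL : (completeGraph (Fin n)).signlessLaplacianMatrix =
      ((n : ℝ) - 1) • 1 + (completeGraph (Fin n)).adjacencyMatrix := by
    rw [← degMatrix_completeGraph, signlessLaplacianMatrix_eq]
  refine le_trans ?_ (Matrix.two_mul_abs_sub_le_sum_abs_matrixSpec_sub
    (μ := ((n : ℝ) - 1) + (n - 1)) (v := 1)
    (signlessLaplacianMatrix_isHermitian _) one_ne_zero ?_ ?_)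
  · rw [averageDegree_completeGraph, add_sub_cancel_left]
    linarith [le_abs_self ((n : ℝ) - 1)]
  · rw [hL, Matrix.add_mulVec, adjacencyMatrix_completeGraph_mulVec_one, Matrix.smul_mulVec,
      Matrix.one_mulVec, add_smul]
  · rw [hL, averageDegree_completeGraph]
    simp [adjacencyMatrix_trace]

theorem le_cnEnergy_completeGraph :
    2 * (((n : ℝ) - 2) * (n - 1)) ≤ (completeGraph (Fin n)).cnEnergy := by
  rw [cnEnergy_eq]
  refine le_trans ?_ (Matrix.two_mul_abs_sub_le_sum_abs_matrixSpec_sub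
    (μ := ((n : ℝ) - 2) * (n - 1)) (v := 1) (cnMatrix_isHermitian _) one_ne_zero ?_ ?_)
  · rw [sub_zero]
    linarith [le_abs_self (((n : ℝ) - 2) * (n - 1))]
  · rw [cnMatrix_completeGraph, Matrix.smul_mulVec, adjacencyMatrix_completeGraph_mulVec_one,
      smul_smul]
  · simp [cnMatrix_completeGraph, adjacencyMatrix_trace]

end Complete

end SimpleGraph

/-! ### Positive semidefinite matrices supported on stars -/

section Star

variable {X Y : Type*} [Fintype X] (f : X → Y)

open scoped Classical in
/-- The number of elements of `X` over `y`, as a real number. -/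
noncomputable def fiberCard (y : Y) : ℝ := ((Finset.univ.filter fun x => f x = y).card : ℝ)

theorem one_le_fiberCard (x : X) : 1 ≤ fiberCard f (f x) := by
  classical
  unfold fiberCard
  exact_mod_cast Finset.card_pos.2 ⟨x, by simp⟩

theorem fiberCard_nonneg (y : Y) : 0 ≤ fiberCard f y := Nat.cast_nonneg _

variable [Fintype Y]

open scoped Classical in
/-- The sum over `y` of the rank one matrices `u uᵀ`, where `u` is `α y` at `y`, `β y` on the fiber
of `f` over `y`, and zero elsewhere. -/
noncomputable def starMatrix (α β : Y → ℝ) : Matrix (X ⊕ Y) (X ⊕ Y) ℝ :=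
  Matrix.fromBlocks (Matrix.of fun x x' => if f x = f x' then β (f x) ^ 2 else 0)
    (Matrix.of fun x y => if f x = y then α y * β y else 0)
    (Matrix.of fun y x => if f x = y then α y * β y else 0)
    (Matrix.diagonal fun y => α y ^ 2)

theorem starMatrix_posSemidef (α β : Y → ℝ) : (starMatrix f α β).PosSemidef := by
  classical
  -- The columns of `W` are the vectors `u`, one for each `y`.
  let W : Matrix (X ⊕ Y) Y ℝ :=
    Matrix.fromRows (Matrix.of fun x y => if f x = y then β y else 0) (Matrix.diagonal α)
  have h : starMatrix f α β = W * Wᴴ := by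
    ext (x | y) (x' | y')
    · by_cases h : f x = f x'
      · simp [W, starMatrix, Matrix.mul_apply, h, sq]
      · simp [W, starMatrix, Matrix.mul_apply, h]
    · by_cases h : f x = y'
      · simp [W, starMatrix, Matrix.mul_apply, Matrix.diagonal_apply, h, mul_comm]
      · simp [W, starMatrix, Matrix.mul_apply, Matrix.diagonal_apply, h]
    · by_cases h : f x' = y
      · simp [W, starMatrix, Matrix.mul_apply, Matrix.diagonal_apply, h]
      · simp [W, starMatrix, Matrix.mul_apply, Matrix.diagonal_apply, h, Ne.symm h]
    · by_cases h : y = y'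
      · simp [W, starMatrix, Matrix.mul_apply, Matrix.diagonal_apply, h, sq]
      · simp [W, starMatrix, Matrix.mul_apply, Matrix.diagonal_apply, h]
  rw [h]
  exact Matrix.posSemidef_self_mul_conjTranspose _

theorem sum_comp_eq_sum_fiberCard_mul (g : Y → ℝ) : ∑ x, g (f x) = ∑ y, fiberCard f y * g y := by
  classical
  rw [← Finset.sum_fiberwise_of_maps_to (s := Finset.univ) (t := Finset.univ) (g := f)
    (fun _ _ => Finset.mem_univ _)]
  refine Finset.sum_congr rfl fun y _ => ?_
  rw [Finset.sum_congr rfl (g := fun _ => g y) (fun x hx => by rw [(Finset.mem_filter.1 hx).2])]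
  simp [fiberCard]

theorem sum_fiberCard : ∑ y, fiberCard f y = Fintype.card X := by
  simpa using (sum_comp_eq_sum_fiberCard_mul f fun _ => 1).symm

theorem starMatrix_trace (α β : Y → ℝ) :
    (starMatrix f α β).trace = ∑ y, (α y ^ 2 + fiberCard f y * β y ^ 2) := by
  rw [Finset.sum_add_distrib, ← sum_comp_eq_sum_fiberCard_mul f fun y => β y ^ 2]
  simp [starMatrix, Matrix.trace, add_comm]

end Star

/-! ### The star structure of the graph and its matrices -/

namespace SubgroupGenerating

variable (G : Type*) [Group G]

/-- The subgroup generated by a pair. -/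
def pairClosure (x : G × G) : Subgroup G := Subgroup.closure {x.1, x.2}

@[simp]
theorem sgbGraph_adj_inl_inl (x x' : G × G) :
    ¬ (sgbGraph G).Adj (Sum.inl x) (Sum.inl x') := id

@[simp]
theorem sgbGraph_adj_inr_inr (y y' : Subgroup G) :
    ¬ (sgbGraph G).Adj (Sum.inr y) (Sum.inr y') := id

@[simp]
theorem sgbGraph_adj_inl_inr (x : G × G) (y : Subgroup G) :
    (sgbGraph G).Adj (Sum.inl x) (Sum.inr y) ↔ pairClosure G x = y := Iff.rfl

@[simp]
theorem sgbGraph_adj_inr_inl (x : G × G) (y : Subgroup G) :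
    (sgbGraph G).Adj (Sum.inr y) (Sum.inl x) ↔ pairClosure G x = y := Iff.rfl

-- Distinct pairs share a neighbor, and then only one, exactly when they generate the same subgroup.
-- This gives an all-ones block on each fiber, with the diagonal removed.
open scoped Classical in
theorem cnMatrix_sgbGraph : (sgbGraph G).cnMatrix =
    starMatrix (pairClosure G) 0 1 - Matrix.fromBlocks 1 0 0 0 := by
  have key : ∀ x x' : G × G, pairClosure G x = pairClosure G x' →
      (sgbGraph G).commonNeighbors (Sum.inl x) (Sum.inl x') = {Sum.inr (pairClosure G x)} := by
    intro x x' h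
    ext (z | y)
    · simp [SimpleGraph.mem_commonNeighbors]
    · simp [SimpleGraph.mem_commonNeighbors, ← h, eq_comm]
  have key0 : ∀ x x' : G × G, pairClosure G x ≠ pairClosure G x' →
      (sgbGraph G).commonNeighbors (Sum.inl x) (Sum.inl x') = ∅ := by
    intro x x' h
    ext (z | y)
    · simp [SimpleGraph.mem_commonNeighbors]
    · simp only [SimpleGraph.mem_commonNeighbors, sgbGraph, Set.mem_empty_iff_false, iff_false]
      exact fun h' => h (h'.1.trans h'.2.symm)
  ext (x | y) (x' | y')
  · by_cases hx : x = x'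
    · simp [SimpleGraph.cnMatrix, starMatrix, hx]
    · by_cases h : pairClosure G x = pairClosure G x'
      · simp [SimpleGraph.cnMatrix, starMatrix, hx, h, key _ _ h]
      · simp [SimpleGraph.cnMatrix, starMatrix, hx, h, key0 _ _ h]
  · have : (sgbGraph G).commonNeighbors (Sum.inl x) (Sum.inr y') = ∅ := by
      ext (z | y) <;> simp [SimpleGraph.mem_commonNeighbors]
    simp [SimpleGraph.cnMatrix, starMatrix, this]
  · have : (sgbGraph G).commonNeighbors (Sum.inr y) (Sum.inl x') = ∅ := by
      ext (z | y) <;> simp [SimpleGraph.mem_commonNeighbors]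
    simp [SimpleGraph.cnMatrix, starMatrix, this]
  · by_cases hy : y = y'
    · simp [SimpleGraph.cnMatrix, starMatrix, hy]
    · have : (sgbGraph G).commonNeighbors (Sum.inr y) (Sum.inr y') = ∅ := by
        ext (z | w)
        · simp only [SimpleGraph.mem_commonNeighbors, sgbGraph, Set.mem_empty_iff_false, iff_false]
          exact fun h' => hy (h'.1.symm.trans h'.2)
        · simp [SimpleGraph.mem_commonNeighbors]
      simp [SimpleGraph.cnMatrix, starMatrix, hy, this]

open scoped Classical in
theorem adjacencyMatrix_sgbGraph : (sgbGraph G).adjacencyMatrix =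
    Matrix.fromBlocks 0 (Matrix.of fun x y => if pairClosure G x = y then 1 else 0)
      (Matrix.of fun y x => if pairClosure G x = y then 1 else 0) 0 := by
  ext (x | y) (x' | y') <;>
    simp [SimpleGraph.adjacencyMatrix, SimpleGraph.adjMatrix_apply]

variable [Fintype G] [Fintype (Subgroup G)]

open scoped Classical in
theorem degree_inl (x : G × G) : (sgbGraph G).degree (Sum.inl x) = 1 := by
  rw [SimpleGraph.degree, Finset.card_eq_one]
  refine ⟨Sum.inr (pairClosure G x), ?_⟩
  ext (x' | y) <;> simp [eq_comm]

open scoped Classical in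
theorem degree_inr (y : Subgroup G) :
    ((sgbGraph G).degree (Sum.inr y) : ℝ) = fiberCard (pairClosure G) y := by
  rw [SimpleGraph.degree, fiberCard, Nat.cast_inj]
  rw [← Finset.card_map (Function.Embedding.inl : G × G ↪ (G × G) ⊕ Subgroup G)]
  congr 1
  ext (x' | y) <;> simp

open scoped Classical in
theorem degMatrix_sgbGraph : (sgbGraph G).degMatrix ℝ =
    Matrix.diagonal (Sum.elim (fun _ => 1) (fiberCard (pairClosure G))) := by
  rw [SimpleGraph.degMatrix]
  congr 1
  ext (x | y)
  · simp [degree_inl]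
  · simp [degree_inr]

theorem averageDegree_sgbGraph_mul_card :
    (sgbGraph G).averageDegree * (Fintype.card (G × G) + Fintype.card (Subgroup G)) =
      2 * Fintype.card (G × G) := by
  classical
  have h := (sgbGraph G).averageDegree_mul_card
  rw [Fintype.sum_sum_type] at h
  simp only [degree_inl, degree_inr, sum_fiberCard, Fintype.card_sum] at h
  push_cast at h
  rw [h]
  simp
  ring

/-! ### Upper bounds for the energies -/

theorem energy_sgbGraph_le :
    (sgbGraph G).energy ≤ ∑ y, 2 * √(fiberCard (pairClosure G) y) := by
  classical
  set d := fiberCard (pairClosure G)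
  -- Flipping the sign of `β` leaves `P - Q` with off-diagonal entry 2αβ, so αβ = 1/2 is required.
  -- Balancing centre against leaves, α² = dβ², minimises the trace. If `d y = 0`, both weights are
  -- 0 by the division convention.
  let α : Subgroup G → ℝ := fun y => √(√(d y) / 2)
  let β : Subgroup G → ℝ := fun y => 1 / (2 * α y)
  have hα : ∀ y, α y ^ 2 = √(d y) / 2 := fun y => Real.sq_sqrt (by positivity)
  have hβ : ∀ y, d y * β y ^ 2 = √(d y) / 2 := fun y => by
    simp only [β, div_pow, mul_pow, hα]
    have hd := Real.sq_sqrt (fiberCard_nonneg (pairClosure G) y)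
    change √(d y) ^ 2 = d y at hd
    rcases eq_or_ne √(d y) 0 with h0 | h0
    · simp [h0]
    · rw [← hd, Real.sqrt_sq (Real.sqrt_nonneg _)]
      field_simp
  have hαβ : ∀ x, α (pairClosure G x) * β (pairClosure G x) = 1 / 2 := fun x => by
    have h0 : 0 < α (pairClosure G x) := by
      have : 0 < d (pairClosure G x) := one_pos.trans_le (one_le_fiberCard _ x)
      simp only [α]
      positivity
    simp only [β]
    field_simp
  rw [SimpleGraph.energy_eq]
  refine (Matrix.sum_abs_matrixSpec_sub_le (r := 0) (SimpleGraph.adjacencyMatrix_isHermitian _)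
    (starMatrix_posSemidef (pairClosure G) α β)
    (starMatrix_posSemidef (pairClosure G) α (-β)) ?_).trans_eq ?_
  · rw [adjacencyMatrix_sgbGraph]
    ext (x | y) (x' | y')
    · simp [starMatrix]
    · by_cases h : pairClosure G x = y'
      · subst h
        simp [starMatrix, hαβ]
        norm_num
      · simp [starMatrix, h]
    · by_cases h : pairClosure G x' = y
      · subst h
        simp [starMatrix, hαβ]
        norm_num
      · simp [starMatrix, h]
    · simp [starMatrix]
  · rw [starMatrix_trace, starMatrix_trace, abs_zero, zero_mul, add_zero, ← Finset.sum_add_distrib]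
    refine Finset.sum_congr rfl fun y _ => ?_
    have := hα y
    have := hβ y
    simp only [Pi.neg_apply, neg_sq]
    change α y ^ 2 + d y * β y ^ 2 + (α y ^ 2 + d y * β y ^ 2) = _
    linarith

theorem energy_sgbGraph_lt [Nontrivial G] :
    (sgbGraph G).energy < Fintype.card ((G × G) ⊕ Subgroup G) := by
  classical
  refine (energy_sgbGraph_le G).trans_lt ?_
  have hle : ∀ d : ℝ, 0 ≤ d → 2 * √d ≤ d + 1 := fun d hd => by
    nlinarith [Real.sq_sqrt hd, sq_nonneg (√d - 1)]
  obtain ⟨g, hg⟩ := exists_ne (1 : G)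
  have hcard : (2 : ℝ) ≤ fiberCard (pairClosure G) (pairClosure G (g, 1)) := by
    unfold fiberCard
    have : 1 < (Finset.univ.filter fun x => pairClosure G x = pairClosure G (g, 1)).card := by
      -- Swapping a pair does not change the subgroup it generates.
      refine Finset.one_lt_card.2 ⟨(g, 1), by simp, (1, g), ?_, by simp [hg]⟩
      simp [pairClosure, Set.pair_comm]
    exact_mod_cast this
  calc ∑ y, 2 * √(fiberCard (pairClosure G) y)
      < ∑ y, (fiberCard (pairClosure G) y + 1) := by
        refine Finset.sum_lt_sum (fun y _ => hle _ (fiberCard_nonneg _ y))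
          ⟨pairClosure G (g, 1), Finset.mem_univ _, ?_⟩
        have h0 := fiberCard_nonneg (pairClosure G) (pairClosure G (g, 1))
        generalize fiberCard (pairClosure G) (pairClosure G (g, 1)) = d at *
        have h1 : 1 < √d := by
          rw [Real.lt_sqrt] <;> linarith
        nlinarith [Real.sq_sqrt h0]
    _ = _ := by
        rw [Finset.sum_add_distrib, sum_fiberCard, Fintype.card_sum]
        simp

open scoped Classical in
/-- The bound shared by the Laplacian (`σ = -1`) and the signless Laplacian (`σ = 1`). -/
theorem sum_abs_matrixSpec_sub_averageDegree_le {M : Matrix ((G × G) ⊕ Subgroup G) _ ℝ}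
    (hM : M.IsHermitian) {σ : ℝ} (hσ : σ ^ 2 = 1)
    (h : M = Matrix.diagonal (Sum.elim (fun _ => 1) (fiberCard (pairClosure G))) +
      σ • (sgbGraph G).adjacencyMatrix) :
    ((matrixSpec M).map fun μ => |μ - (sgbGraph G).averageDegree|).sum ≤
      2 * ((Fintype.card ((G × G) ⊕ Subgroup G) : ℝ) - 1) := by
  classical
  set d := fiberCard (pairClosure G)
  set a := (sgbGraph G).averageDegree with ha
  let s : Subgroup G → ℝ := fun y => √(d y + 1)
  have hd : ∀ y, 0 ≤ d y := fiberCard_nonneg _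
  have hs : ∀ y, s y ^ 2 = d y + 1 := fun y => Real.sq_sqrt (by linarith [hd y])
  have hd' : ∀ y, d y + 1 ≠ 0 := fun y => by linarith [hd y]
  have hs' : ∀ y, s y ≠ 0 := fun y h0 => hd' y (by rw [← hs, h0]; norm_num)
  have hA : ∀ y, d y / s y * (σ / s y) - 1 / s y * (-σ / s y) = σ := fun y => by
    have := hs y
    have := hs' y
    field_simp
    rw [hs]
    ring
  -- After subtracting 1, a star has `d` and -1 as its possible nonzero eigenvalues, with
  -- eigenvectors proportional to (d, σ, …, σ) and (1, -σ, …, -σ). Dividing by `s` gives the rank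
  -- one parts traces `d` and 1.
  refine (Matrix.sum_abs_matrixSpec_sub_le (r := 1 - a) hM
    (starMatrix_posSemidef (pairClosure G) (fun y => d y / s y) (fun y => σ / s y))
    (starMatrix_posSemidef (pairClosure G) (fun y => 1 / s y) (fun y => -σ / s y)) ?_).trans ?_
  · rw [h, adjacencyMatrix_sgbGraph]
    ext (x | y) (x' | y')
    · by_cases hx : x = x'
      · subst hx
        simp [starMatrix, div_pow]
      · simp [starMatrix, hx, div_pow]
    · by_cases h : pairClosure G x = y'
      · subst h
        simpa [starMatrix] using (hA _).symm
      · simp [starMatrix, h]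
    · by_cases h : pairClosure G x' = y
      · subst h
        simpa [starMatrix] using (hA _).symm
      · simp [starMatrix, h]
    · by_cases hy : y = y'
      · subst hy
        simp only [starMatrix, Matrix.sub_apply, Matrix.add_apply, Matrix.smul_apply,
          Matrix.fromBlocks_apply₂₂, Matrix.diagonal_apply_eq, Matrix.one_apply_eq, div_pow, hs,
          Sum.elim_inr, Matrix.zero_apply, smul_eq_mul]
        have := hd' y
        field_simp
        ring
      · simp [starMatrix, hy]
  · rw [starMatrix_trace, starMatrix_trace]
    have h1 : ∑ y, ((d y / s y) ^ 2 + fiberCard (pairClosure G) y * (σ / s y) ^ 2) =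
        (Fintype.card (G × G) : ℝ) := by
      rw [← sum_fiberCard (pairClosure G)]
      refine Finset.sum_congr rfl fun y _ => ?_
      change (d y / s y) ^ 2 + d y * (σ / s y) ^ 2 = d y
      rw [div_pow, div_pow, hs, hσ]
      have := hd' y
      field_simp
    have h2 : ∑ y, ((1 / s y) ^ 2 + fiberCard (pairClosure G) y * (-σ / s y) ^ 2) =
        (Fintype.card (Subgroup G) : ℝ) := by
      rw [← mul_one (Fintype.card (Subgroup G) : ℝ), ← nsmul_eq_mul, ← Finset.card_univ,
        ← Finset.sum_const]
      refine Finset.sum_congr rfl fun y _ => ?_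
      change (1 / s y) ^ 2 + d y * (-σ / s y) ^ 2 = 1
      rw [div_pow, div_pow, hs, neg_sq, hσ]
      have := hd' y
      field_simp
      ring
    have ha' := averageDegree_sgbGraph_mul_card G
    rw [← ha] at ha'
    have hN : (1 : ℝ) ≤ Fintype.card (G × G) := by exact_mod_cast Fintype.card_pos
    have hS : (1 : ℝ) ≤ Fintype.card (Subgroup G) := by exact_mod_cast Fintype.card_pos
    rw [h1, h2, Fintype.card_sum, Nat.cast_add]
    set N : ℝ := (Fintype.card (G × G) : ℝ)
    set S : ℝ := (Fintype.card (Subgroup G) : ℝ)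
    -- The average degree is a = 2N / (N + S).
    have h3 : |1 - a| * (N + S) = |S - N| := by
      rw [← abs_of_nonneg (show 0 ≤ N + S by linarith), ← abs_mul]
      congr 1
      linarith
    rw [h3]
    have : |S - N| ≤ S + N - 2 := abs_le.2 ⟨by linarith, by linarith⟩
    linarith

theorem laplacianEnergy_sgbGraph_le : (sgbGraph G).laplacianEnergy ≤
    2 * (Fintype.card ((G × G) ⊕ Subgroup G) - 1) := by
  classical
  refine sum_abs_matrixSpec_sub_averageDegree_le G (SimpleGraph.laplacianMatrix_isHermitian _)
    (σ := -1) (by norm_num) ?_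
  rw [← degMatrix_sgbGraph, neg_one_smul, ← sub_eq_add_neg, SimpleGraph.laplacianMatrix_eq]

theorem signlessLaplacianEnergy_sgbGraph_le : (sgbGraph G).signlessLaplacianEnergy ≤
    2 * (Fintype.card ((G × G) ⊕ Subgroup G) - 1) := by
  classical
  refine sum_abs_matrixSpec_sub_averageDegree_le G
    (SimpleGraph.signlessLaplacianMatrix_isHermitian _) (σ := 1) (by norm_num) ?_
  rw [← degMatrix_sgbGraph, one_smul, SimpleGraph.signlessLaplacianMatrix_eq]

theorem cnEnergy_sgbGraph_le : (sgbGraph G).cnEnergy ≤ 2 * Fintype.card (G × G) := by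
  classical
  rw [SimpleGraph.cnEnergy_eq]
  have hpos : (Matrix.fromBlocks 1 0 0 0 :
      Matrix ((G × G) ⊕ Subgroup G) ((G × G) ⊕ Subgroup G) ℝ).PosSemidef := by
    have : (Matrix.fromBlocks 1 0 0 0 : Matrix ((G × G) ⊕ Subgroup G) _ ℝ) =
        Matrix.diagonal (Sum.elim (fun _ => 1) (fun _ => 0)) := by
      ext (x | y) (x' | y') <;> simp [Matrix.diagonal_apply, Matrix.one_apply]
    rw [this, Matrix.posSemidef_diagonal_iff]
    rintro (x | y) <;> simp
  refine (Matrix.sum_abs_matrixSpec_sub_le (r := 0) (SimpleGraph.cnMatrix_isHermitian _)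
    (starMatrix_posSemidef (pairClosure G) 0 1) hpos (by simp [cnMatrix_sgbGraph])).trans_eq ?_
  rw [starMatrix_trace]
  simp only [Pi.zero_apply, Pi.one_apply, one_pow, mul_one, ne_eq, OfNat.ofNat_ne_zero,
    not_false_eq_true, zero_pow, zero_add, sum_fiberCard]
  simp [Matrix.trace]
  ring

open SimpleGraph in
/-- The subgroup generating bipartite graph of a nontrivial finite group is hypoenergetic, and not
hyperenergetic with respect to any of the four energies. -/
theorem sgbGraph_energies [Nontrivial G] :
    (sgbGraph G).IsHypoenergetic ∧ ¬ (sgbGraph G).IsHyperenergetic ∧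
    ¬ (sgbGraph G).IsLHyperenergetic ∧ ¬ (sgbGraph G).IsQHyperenergetic ∧
    ¬ (sgbGraph G).IsCNHyperenergetic := by
  have h4 : (4 : ℝ) ≤ Fintype.card (G × G) := by
    have : 1 < Fintype.card G := Fintype.one_lt_card
    rw [Fintype.card_prod]
    exact_mod_cast (by nlinarith : 4 ≤ Fintype.card G * Fintype.card G)
  have hS : (1 : ℝ) ≤ Fintype.card (Subgroup G) := by exact_mod_cast Fintype.card_pos
  have hn : (Fintype.card ((G × G) ⊕ Subgroup G) : ℝ) =
      Fintype.card (G × G) + Fintype.card (Subgroup G) := by rw [Fintype.card_sum, Nat.cast_add]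
  have : NeZero (Fintype.card ((G × G) ⊕ Subgroup G)) := ⟨Fintype.card_ne_zero⟩
  refine ⟨energy_sgbGraph_lt G, not_lt.2 ?_, not_lt.2 ?_, not_lt.2 ?_, not_lt.2 ?_⟩
  -- It remains that n ≤ 2(n - 1), which holds as n ≥ 5.
  · refine (energy_sgbGraph_lt G).le.trans (le_trans ?_ (le_energy_completeGraph _))
    linarith
  · exact (laplacianEnergy_sgbGraph_le G).trans (le_laplacianEnergy_completeGraph _)
  · exact (signlessLaplacianEnergy_sgbGraph_le G).trans
      (le_signlessLaplacianEnergy_completeGraph _)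
  · refine (cnEnergy_sgbGraph_le G).trans (le_trans ?_ (le_cnEnergy_completeGraph _))
    rw [hn]
    -- With S ≥ 1 and N ≥ 4, (n - 2)(n - 1) ≥ (N - 1)N ≥ N.
    nlinarith

end SubgroupGenerating

theorem mainTheorem10 (p : ℕ) [Fact p.Prime] :
    (sgbGraph (QuaternionGroup (p ^ 2))).IsHypoenergetic ∧
    ¬ (sgbGraph (QuaternionGroup (p ^ 2))).IsHyperenergetic ∧
    ¬ (sgbGraph (QuaternionGroup (p ^ 2))).IsLHyperenergetic ∧
    ¬ (sgbGraph (QuaternionGroup (p ^ 2))).IsQHyperenergetic ∧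
    ¬ (sgbGraph (QuaternionGroup (p ^ 2))).IsCNHyperenergetic := by
  exact SubgroupGenerating.sgbGraph_energies _
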